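/- Let $F=\mathbb F_q$ be a finite field, $n$ a natural number, and let $U=U_n(q)$ be the group of upper unitriangular $n\times n$ matrices over $F$. Let $\Sigma^+$ be the set of positive roots $\alpha_{i,j}=\alpha_i+\dots+\alpha_j$, $0<i\le j<n$, of $GL_n(q)$, and for $\alpha=\alpha_{i,j}$ let $X_\alpha=\{I_n+c\,e_{i,j+1}: c\in F\}$ be its root subgroup; $\alpha_{i,j}$ is said to lie in row $i$ and column $j+1$. Put $\operatorname{arm}(\alpha_{i,j})=\{\alpha_{i,l}: i\le l<j\}$ and $V_\alpha=\langle X_\beta:\beta\in\Sigma^+\setminus\operatorname{arm}(\alpha)\rangle$. Let $\Lambda_\alpha$ be the set of linear characters $\lambda: V_\alpha\to\mathbb C^\times$ that are nontrivial on $X_\alpha$ and trivial on every other root subgroup $X_\beta\subseteq V_\alpha$; the induced characters $\lambda^U$ with $\lambda\in\Lambda_\alpha$ are the elementary characters at $\alpha$. A basic set is a nonempty set $D\subseteq\Sigma^+$ no two distinct elements of which lie in the same row or in the same column; for a basic set $D$ and a choice $\phi=(\lambda_\alpha)_{\alpha\in D}$ with $\lambda_\alpha\in\Lambda_\alpha$,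 the basic character is $\xi_{D,\phi}=\bigotimes_{\alpha\in D}\lambda_\alpha^U$. Let $S$ be a nonempty subset of $\Sigma^+$ and choose $\lambda_\alpha\in\Lambda_\alpha$ for every $\alpha\in S$. Then the tensor product $\bigotimes_{\alpha\in S}\lambda_\alpha^U$ decomposes into a sum of basic characters, i.e. there are non-negative integers $m_{D,\phi}$ with $$\bigotimes_{\alpha\in S}\lambda_\alpha^U=\sum_{D,\phi} m_{D,\phi}\,\xi_{D,\phi},$$ where the sum runs over all basic sets $D$ and all choices $\phi$ as above. -/

import Mathlib

namespace UnitriChar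

/-- The positive roots of the root system of `GL_n`. The root
`α_{i,j} = α_i + ⋯ + α_j` with `1 ≤ i ≤ j < n` is recorded as the matrix position
`(i, j + 1)` of its root subgroup, so the positive roots are exactly the positions
strictly above the diagonal. -/
abbrev PosRoot (n : ℕ) : Type := {p : Fin n × Fin n // p.1 < p.2}

/-- The row of a positive root. -/
abbrev PosRoot.row {n : ℕ} (α : PosRoot n) : Fin n := α.1.1

/-- The column of a positive root. -/
abbrev PosRoot.col {n : ℕ} (α : PosRoot n) : Fin n := α.1.2

/-- The arm of a root: the roots in the same row, strictly to its left
(`arm (α_{i,j}) = {α_{i,l} : i ≤ l < j}`). -/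
def arm {n : ℕ} (α : PosRoot n) : Set (PosRoot n) :=
  {β | β.row = α.row ∧ β.col < α.col}

/-- Two roots are separate if they lie neither in the same row nor in the same column. -/
def Separate {n : ℕ} (α β : PosRoot n) : Prop :=
  α.row ≠ β.row ∧ α.col ≠ β.col

/-- A basic set: a nonempty set of positive roots that are pairwise separate. -/
def IsBasic {n : ℕ} (D : Finset (PosRoot n)) : Prop :=
  D.Nonempty ∧ (D : Set (PosRoot n)).Pairwise Separate

/-- The matrix `I + c • e_{α}` as an element of `GL_n(F)`. -/
def rootElement (F : Type*) [Field F] {n : ℕ} (α : PosRoot n) (c : F) : GL (Fin n) F :=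
  (Matrix.SpecialLinearGroup.transvection (ne_of_lt α.2) c : Matrix.SpecialLinearGroup (Fin n) F)

/-- The root subgroup `X_α = {I + c • e_α : c ∈ F}`. -/
def rootSubgroup (F : Type*) [Field F] {n : ℕ} (α : PosRoot n) : Subgroup (GL (Fin n) F) where
  carrier := Set.range (rootElement F α)
  one_mem' := ⟨0, by
    apply Units.ext
    simp [rootElement]⟩
  mul_mem' := by
    rintro _ _ ⟨a, rfl⟩ ⟨b, rfl⟩
    refine ⟨a + b, ?_⟩
    apply Units.ext
    exact (Matrix.transvection_mul_transvection_same α.1.1 α.1.2 (ne_of_lt α.2) a b).symm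
  inv_mem' := by
    rintro _ ⟨a, rfl⟩
    refine ⟨-a, ?_⟩
    rw [eq_inv_iff_mul_eq_one]
    apply Units.ext
    have h := Matrix.transvection_mul_transvection_same α.1.1 α.1.2 (ne_of_lt α.2) (-a) a
    rw [neg_add_cancel, Matrix.transvection_zero] at h
    exact h

/-- The upper triangular group `U_n(F)`, generated by all root subgroups. -/
def U (F : Type*) [Field F] (n : ℕ) : Subgroup (GL (Fin n) F) :=
  ⨆ α : PosRoot n, rootSubgroup F α

/-- The base group `V_α`, generated by the root subgroups `X_β` with `β` not in the arm
of `α`, as a subgroup of `U_n(F)`. -/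
def V (F : Type*) [Field F] {n : ℕ} (α : PosRoot n) : Subgroup (U F n) :=
  ⨆ β : PosRoot n, ⨆ _ : β ∉ arm α, (rootSubgroup F β).subgroupOf (U F n)

/-- The linear characters of `V_α` that are nontrivial on `X_α` and trivial on every other
root subgroup `X_β` contained in `V_α`. -/
def RootChar (F : Type*) [Field F] {n : ℕ} (α : PosRoot n) : Type _ :=
  {lam : V F α →* ℂˣ //
    (∃ x : V F α, ((x : U F n) : GL (Fin n) F) ∈ rootSubgroup F α ∧ lam x ≠ 1) ∧
    ∀ β : PosRoot n, β ∉ arm α → β ≠ α →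
      ∀ x : V F α, ((x : U F n) : GL (Fin n) F) ∈ rootSubgroup F β → lam x = 1}

open Classical in
/-- The character of the finite group `G` induced from a linear character `lam` of the
subgroup `H`: `g ↦ |H|⁻¹ ∑_{x ∈ G} lam°(x g x⁻¹)`, where `lam°` is `lam` on `H` and `0`
off `H`. -/
noncomputable def inducedChar {G : Type*} [Group G] [Finite G] (H : Subgroup G)
    (lam : H →* ℂˣ) : G → ℂ :=
  letI := Fintype.ofFinite G
  fun g => (Nat.card H : ℂ)⁻¹ *
    ∑ x : G, if h : x * g * x⁻¹ ∈ H then (lam ⟨x * g * x⁻¹, h⟩ : ℂ) else 0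

/-- The elementary character `lam^U` at the root `α`. -/
noncomputable def elementaryChar {F : Type*} [Field F] [Finite F] {n : ℕ} {α : PosRoot n}
    (lam : RootChar F α) : U F n → ℂ :=
  inducedChar (V F α) lam.1

/-- The tensor product of the elementary characters `(phi α)^U`, `α ∈ S`, one for each root
of `S` (the character of a tensor product is the pointwise product). -/
noncomputable def tensorChar {F : Type*} [Field F] [Finite F] {n : ℕ} (S : Finset (PosRoot n))
    (phi : ∀ α : S, RootChar F α.1) : U F n → ℂ :=
  ∏ α : S, elementaryChar (phi α)

/-- The index `(D, φ)` of a basic character: a basic set `D` and a choice `φ` of one linear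
character of `V_α` for each `α ∈ D`. -/
structure BasicIndex (F : Type*) [Field F] (n : ℕ) where
  D : Finset (PosRoot n)
  isBasic : IsBasic D
  phi : ∀ α : D, RootChar F α.1

/-- The basic character `ξ_{D,φ}`. -/
noncomputable def basicChar {F : Type*} [Field F] [Finite F] {n : ℕ}
    (b : BasicIndex F n) : U F n → ℂ :=
  tensorChar b.D b.phi

end UnitriChar

/-! Fix a primitive additive character `ψ` of `F`. For `α` at position `(i, k)`, the right cosets of
`V F α` are labelled by the part of row `i` to the left of column `k`. Hence every elementary
character at `α` takes at `g` the value `∑ ψ (a * (v g)_k)` for some `a ≠ 0`, where `v` runs over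
the row vectors with leading entry `1` at `i`, supported below `k` and fixed by `g` in the
coordinates below `k` (`exists_eq_rootChar`, `elementaryChar_rootChar`).

Translating these vectors simplifies the product of two such sums at non-separate roots. If the
roots are distinct, the longer factor survives and the shorter one is replaced by a sum over vectors
with later leading entry (same row) or by a count of fixed vectors (same column). At equal roots,
the parameters add up and a sum of the first kind splits off. Both kinds of leftover are the trivial
character plus elementary characters at strictly shorter roots (`exists_tailSum_eq`,
`exists_headSum_zero_eq`).

Each rewriting lowers the total height, so it ends in products over pairwise separate roots. The
trivial character is not basic, so one factor of maximal height is set aside. Its root occurs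
nowhere else, so it survives every rewriting and no product becomes empty (`elemChar_mul_prod_mem`).
-/

namespace UnitriChar

open Matrix

/-! ### Exponential sums over fixed row vectors of a unitriangular matrix -/

section Vectors

variable {F : Type*} [Field F] {n : ℕ}

/-- Upper unitriangular matrices. -/
def IsUnitri (A : Matrix (Fin n) (Fin n) F) : Prop :=
  (∀ i, A i i = 1) ∧ ∀ i j, j < i → A i j = 0

/-- The restriction of a row vector to the coordinates below `k`. -/
def trunc (k : ℕ) (v : Fin n → F) : Fin n → F := fun l => if (l : ℕ) < k then v l else 0

lemma vecMul_trunc_of_lt {A : Matrix (Fin n) (Fin n) F} (hA : IsUnitri A) {k : ℕ}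
    (v : Fin n → F) {l : Fin n} (hl : (l : ℕ) < k) : (trunc k v ᵥ* A) l = (v ᵥ* A) l := by
  simp only [vecMul, dotProduct, trunc]
  refine Finset.sum_congr rfl fun m _ => ?_
  split_ifs with h
  · rfl
  · rw [hA.2 m l (by rw [Fin.lt_def]; omega), mul_zero, mul_zero]

/-- Coordinates beyond `k` do not reach column `k`, so truncation loses only the diagonal term `v k
* A k k = v k`. -/
lemma vecMul_trunc_self {A : Matrix (Fin n) (Fin n) F} (hA : IsUnitri A)
    (v : Fin n → F) (k : Fin n) : (trunc k v ᵥ* A) k = (v ᵥ* A) k - v k := by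
  rw [eq_sub_iff_add_eq]
  simp only [vecMul, dotProduct, trunc]
  have : v k = ∑ m, if m = k then v m * A m k else 0 := by simp [hA.1]
  rw [this, ← Finset.sum_add_distrib]
  refine Finset.sum_congr rfl fun m _ => ?_
  rcases lt_trichotomy m k with h | h | h
  · have h' : (m : ℕ) < k := h
    simp [h', h.ne]
  · subst h; simp
  · have h' : ¬ (m : ℕ) < k := by rw [Fin.lt_def] at h; omega
    simp [h', h.ne', hA.2 m k h]

variable [Fintype F]

open Classical in
/-- The row vectors supported below `k` and fixed by `A` in the coordinates below `k`. -/
noncomputable def fixedVec (A : Matrix (Fin n) (Fin n) F) (k : ℕ) : Finset (Fin n → F) :=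
  Finset.univ.filter fun v =>
    (∀ l : Fin n, k ≤ l → v l = 0) ∧ ∀ l : Fin n, (l : ℕ) < k → (v ᵥ* A) l = v l

open Classical in
/-- The vectors of `fixedVec A k` that vanish below `m`. -/
noncomputable def tailVec (A : Matrix (Fin n) (Fin n) F) (m k : ℕ) : Finset (Fin n → F) :=
  (fixedVec A k).filter fun v => ∀ l : Fin n, (l : ℕ) < m → v l = 0

open Classical in
/-- The vectors of `fixedVec A k` whose leading entry is a `1` in position `i`. -/
noncomputable def headVec (A : Matrix (Fin n) (Fin n) F) (i : Fin n) (k : ℕ) :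
    Finset (Fin n → F) :=
  (tailVec A i k).filter fun v => v i = 1

lemma mem_fixedVec {A : Matrix (Fin n) (Fin n) F} {k : ℕ} {v : Fin n → F} :
    v ∈ fixedVec A k ↔
      (∀ l : Fin n, k ≤ l → v l = 0) ∧ ∀ l : Fin n, (l : ℕ) < k → (v ᵥ* A) l = v l := by
  simp [fixedVec]

lemma mem_tailVec {A : Matrix (Fin n) (Fin n) F} {m k : ℕ} {v : Fin n → F} :
    v ∈ tailVec A m k ↔ v ∈ fixedVec A k ∧ ∀ l : Fin n, (l : ℕ) < m → v l = 0 := by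
  simp [tailVec]

lemma mem_headVec {A : Matrix (Fin n) (Fin n) F} {i : Fin n} {k : ℕ} {v : Fin n → F} :
    v ∈ headVec A i k ↔ v ∈ tailVec A i k ∧ v i = 1 := by
  simp [headVec]

lemma add_mem_fixedVec {A : Matrix (Fin n) (Fin n) F} {k : ℕ} {v w : Fin n → F}
    (hv : v ∈ fixedVec A k) (hw : w ∈ fixedVec A k) : v + w ∈ fixedVec A k := by
  rw [mem_fixedVec] at *
  refine ⟨fun l hl => by simp [hv.1 l hl, hw.1 l hl], fun l hl => ?_⟩
  simp [add_vecMul, hv.2 l hl, hw.2 l hl]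

lemma smul_mem_fixedVec {A : Matrix (Fin n) (Fin n) F} {k : ℕ} {v : Fin n → F} (c : F)
    (hv : v ∈ fixedVec A k) : c • v ∈ fixedVec A k := by
  rw [mem_fixedVec] at *
  refine ⟨fun l hl => by simp [hv.1 l hl], fun l hl => ?_⟩
  simp [smul_vecMul, hv.2 l hl]

lemma add_mem_tailVec {A : Matrix (Fin n) (Fin n) F} {m k : ℕ} {v w : Fin n → F}
    (hv : v ∈ tailVec A m k) (hw : w ∈ tailVec A m k) : v + w ∈ tailVec A m k := by
  rw [mem_tailVec] at *
  exact ⟨add_mem_fixedVec hv.1 hw.1, fun l hl => by simp [hv.2 l hl, hw.2 l hl]⟩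

lemma smul_mem_tailVec {A : Matrix (Fin n) (Fin n) F} {m k : ℕ} {v : Fin n → F} (c : F)
    (hv : v ∈ tailVec A m k) : c • v ∈ tailVec A m k := by
  rw [mem_tailVec] at *
  exact ⟨smul_mem_fixedVec c hv.1, fun l hl => by simp [hv.2 l hl]⟩

lemma tailVec_anti {A : Matrix (Fin n) (Fin n) F} {m m' k : ℕ} (h : m ≤ m') :
    tailVec A m' k ⊆ tailVec A m k := fun v hv => by
  rw [mem_tailVec] at *
  exact ⟨hv.1, fun l hl => hv.2 l (by omega)⟩

lemma mem_tailVec_succ {A : Matrix (Fin n) (Fin n) F} {i : Fin n} {k : ℕ} {v : Fin n → F} :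
    v ∈ tailVec A (i + 1) k ↔ v ∈ tailVec A i k ∧ v i = 0 := by
  rw [mem_tailVec, mem_tailVec, and_assoc]
  refine and_congr_right fun _ => ⟨fun h => ⟨fun l hl => h l (by omega), h i (by omega)⟩,
    fun h l hl => ?_⟩
  rcases Nat.lt_succ_iff_lt_or_eq.1 hl with h' | h'
  · exact h.1 l h'
  · rw [Fin.ext h']; exact h.2

lemma trunc_mem_fixedVec {A : Matrix (Fin n) (Fin n) F} (hA : IsUnitri A) {j k : ℕ}
    (hjk : j ≤ k) {v : Fin n → F} (hv : v ∈ fixedVec A k) : trunc j v ∈ fixedVec A j := by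
  rw [mem_fixedVec] at *
  refine ⟨fun l hl => by simp [trunc, hl.not_gt], fun l hl => ?_⟩
  rw [vecMul_trunc_of_lt hA v hl, hv.2 l (by omega)]
  simp [trunc, hl]

lemma trunc_mem_headVec {A : Matrix (Fin n) (Fin n) F} (hA : IsUnitri A) {i : Fin n} {j k : ℕ}
    (hij : (i : ℕ) < j) (hjk : j ≤ k) {v : Fin n → F} (hv : v ∈ headVec A i k) :
    trunc j v ∈ headVec A i j := by
  rw [mem_headVec, mem_tailVec] at *
  refine ⟨⟨trunc_mem_fixedVec hA hjk hv.1.1, fun l hl => ?_⟩, by simp [trunc, hij, hv.2]⟩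
  simp [trunc, hv.1.2 l hl]

lemma trunc_eq_self {A : Matrix (Fin n) (Fin n) F} {k : ℕ} {v : Fin n → F}
    (hv : v ∈ fixedVec A k) : trunc k v = v := by
  ext l
  simp only [trunc, ite_eq_left_iff, not_lt]
  exact fun h => ((mem_fixedVec.1 hv).1 l h).symm

/-- The sum computing the elementary character with parameter `a` at the root `(i, k)`. -/
noncomputable def headSum (ψ : AddChar F ℂ) (A : Matrix (Fin n) (Fin n) F) (i k : Fin n) (a : F) :
    ℂ :=
  ∑ v ∈ headVec A i k, ψ (a * (v ᵥ* A) k)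

/-- The analogue of `headSum` over the vectors vanishing below `m`. -/
noncomputable def tailSum (ψ : AddChar F ℂ) (A : Matrix (Fin n) (Fin n) F) (m : ℕ) (k : Fin n)
    (a : F) : ℂ :=
  ∑ v ∈ tailVec A m k, ψ (a * (v ᵥ* A) k)

variable (ψ : AddChar F ℂ) {A : Matrix (Fin n) (Fin n) F}

/-- If nonempty, `headVec A i k` is a coset of the additive group `tailVec A (i + 1) k`; translate
by `t`. -/
lemma headSum_eq_mul_tailSum {i k : Fin n} (a : F) {t : Fin n → F} (ht : t ∈ headVec A i k) :
    headSum ψ A i k a = ψ (a * (t ᵥ* A) k) * tailSum ψ A (i + 1) k a := by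
  rw [headSum, tailSum, Finset.mul_sum]
  rw [mem_headVec] at ht
  refine Finset.sum_nbij' (fun v => v + (-1 : F) • t) (fun d => d + t) ?_ ?_ ?_ ?_ ?_
  · intro v hv
    rw [mem_headVec] at hv
    rw [mem_tailVec_succ]
    exact ⟨add_mem_tailVec hv.1 (smul_mem_tailVec _ ht.1), by simp [hv.2, ht.2]⟩
  · intro d hd
    rw [mem_tailVec_succ] at hd
    rw [mem_headVec]
    exact ⟨add_mem_tailVec hd.1 ht.1, by simp [hd.2, ht.2]⟩
  · intro v _; simp
  · intro d _; simp
  · intro v _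
    rw [← AddChar.map_add_eq_mul]
    congr 1
    simp [add_vecMul, neg_vecMul]
    ring

/-- Each `w` in the longer sum supplies a base point `t = trunc j w` for the shorter one. As `A`
fixes coordinate `j` of `w`, the entry `(t A)_j` is zero and the factor `ψ (a * (t A)_j)` is `1`. -/
lemma headSum_mul_headSum_same_row (hA : IsUnitri A) {i j k : Fin n} (hij : i < j) (hjk : j < k)
    (a b : F) :
    headSum ψ A i j a * headSum ψ A i k b = headSum ψ A i k b * tailSum ψ A (i + 1) j a := by
  rw [mul_comm, headSum, Finset.sum_mul, Finset.sum_mul]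
  refine Finset.sum_congr rfl fun w hw => ?_
  rw [headSum_eq_mul_tailSum ψ a (trunc_mem_headVec hA hij hjk.le hw), vecMul_trunc_self hA]
  rw [mem_headVec, mem_tailVec, mem_fixedVec] at hw
  rw [hw.1.1.2 j hjk]
  simp

lemma headSum_mul_headSum_same_root {i k : Fin n} (a b : F) :
    headSum ψ A i k a * headSum ψ A i k b =
      headSum ψ A i k (a + b) * tailSum ψ A (i + 1) k a := by
  rw [mul_comm]
  conv_lhs => rw [headSum.eq_def ψ A i k b]
  conv_rhs => rw [headSum.eq_def ψ A i k (a + b)]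
  rw [Finset.sum_mul, Finset.sum_mul]
  refine Finset.sum_congr rfl fun w hw => ?_
  rw [headSum_eq_mul_tailSum ψ a hw, ← mul_assoc, ← AddChar.map_add_eq_mul]
  congr 2
  ring

/-- Since `w` vanishes at and before `i`, shifting `v` by `(b / a) • w` permutes `headVec A i k`,
and it absorbs the factor `ψ (b * (w A)_k)`. -/
lemma headSum_mul_headSum_same_col {i i' k : Fin n} (hi : i < i') {a : F} (ha : a ≠ 0) (b : F) :
    headSum ψ A i k a * headSum ψ A i' k b = headSum ψ A i k a * headSum ψ A i' k 0 := by
  rw [mul_comm, mul_comm (headSum ψ A i k a)]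
  simp only [headSum, Finset.sum_mul]
  refine Finset.sum_congr rfl fun w hw => ?_
  rw [Finset.mul_sum, Finset.mul_sum]
  rw [mem_headVec] at hw
  have hw1 : w ∈ tailVec A i k := tailVec_anti hi.le hw.1
  have hw2 : w i = 0 := (mem_tailVec.1 hw.1).2 i hi
  refine Finset.sum_nbij' (fun v => v + (b / a) • w) (fun v => v + (-(b / a)) • w) ?_ ?_ ?_ ?_ ?_
  · intro v hv
    rw [mem_headVec] at hv ⊢
    exact ⟨add_mem_tailVec hv.1 (smul_mem_tailVec _ hw1), by simp [hv.2, hw2]⟩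
  · intro v hv
    rw [mem_headVec] at hv ⊢
    exact ⟨add_mem_tailVec hv.1 (smul_mem_tailVec _ hw1), by simp [hv.2, hw2]⟩
  · intro v _; simp
  · intro v _; simp
  · intro v _
    rw [← AddChar.map_add_eq_mul, ← AddChar.map_add_eq_mul]
    congr 1
    simp [add_vecMul, smul_vecMul]
    field_simp
    ring

lemma tailSum_self (k : Fin n) (a : F) : tailSum ψ A k k a = 1 := by
  have : tailVec A k k = {0} := by
    ext v
    rw [mem_tailVec, Finset.mem_singleton, mem_fixedVec]
    constructor
    · rintro ⟨⟨h1, -⟩, h2⟩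
      ext l
      rcases lt_or_ge (l : ℕ) k with h | h
      · exact h2 l h
      · exact h1 l h
    · rintro rfl
      simp
  rw [tailSum, this]
  simp

lemma sum_eq_zero_add_sum_units [Fintype Fˣ] (f : F → ℂ) :
    ∑ c, f c = f 0 + ∑ c : Fˣ, f c := by
  classical
  rw [Fintype.sum_eq_add_sum_subtype_ne f 0]
  congr 1
  exact (Fintype.sum_equiv unitsEquivNeZero _ _ fun c => rfl).symm

/-- Vectors with nonzero entry at `i` are uniquely `c • v` with `v` in `headVec A i k`; the scalar
moves into the parameter. -/
lemma tailSum_eq_add_sum [Fintype Fˣ] (i k : Fin n) (a : F) :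
    tailSum ψ A i k a = tailSum ψ A (i + 1) k a + ∑ c : Fˣ, headSum ψ A i k (a * c) := by
  classical
  have h0 : tailSum ψ A (i + 1) k a =
      ∑ v ∈ (tailVec A i k).filter (fun v => v i = 0), ψ (a * (v ᵥ* A) k) := by
    rw [tailSum]
    refine Finset.sum_congr ?_ fun _ _ => rfl
    ext v
    rw [mem_tailVec_succ, Finset.mem_filter]
  rw [h0, tailSum, ← Finset.sum_filter_add_sum_filter_not _ (fun v => v i = 0)]
  congr 1
  simp only [headSum, Finset.sum_sigma']
  symm
  refine Finset.sum_bij (fun p _ => (p.1 : F) • p.2) ?_ ?_ ?_ ?_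
  · rintro ⟨c, v⟩ h
    simp only [Finset.mem_sigma, Finset.mem_univ, true_and, mem_headVec] at h
    simp only [Finset.mem_filter]
    exact ⟨smul_mem_tailVec _ h.1, by simp [h.2]⟩
  · rintro ⟨c, v⟩ h ⟨c', v'⟩ h' heq
    simp only [Finset.mem_sigma, Finset.mem_univ, true_and, mem_headVec] at h h' heq
    have hc : c = c' := by
      have := congrFun heq i
      simp only [Pi.smul_apply, h.2, h'.2, smul_eq_mul, mul_one] at this
      exact Units.ext this
    subst hc
    have : v = v' := by
      ext l
      have := congrFun heq l
      simpa using this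
    rw [this]
  · intro v hv
    rw [Finset.mem_filter] at hv
    refine ⟨⟨Units.mk0 _ hv.2, (v i)⁻¹ • v⟩, ?_, ?_⟩
    · simp only [Finset.mem_sigma, Finset.mem_univ, true_and, mem_headVec]
      exact ⟨smul_mem_tailVec _ hv.1, by simp [hv.2]⟩
    · simp [smul_smul, hv.2]
  · rintro ⟨c, v⟩ h
    simp [smul_vecMul, mul_assoc]

lemma card_headVec_self (hA : IsUnitri A) (i : Fin n) : (headVec A i (i + 1)).card = 1 := by
  rw [Finset.card_eq_one]
  refine ⟨Pi.single i 1, ?_⟩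
  ext v
  rw [mem_headVec, mem_tailVec, mem_fixedVec, Finset.mem_singleton]
  constructor
  · rintro ⟨⟨⟨h1, -⟩, h2⟩, h3⟩
    ext l
    rcases lt_trichotomy l i with h | h | h
    · rw [h2 l h, Pi.single_eq_of_ne h.ne]
    · rw [h, h3, Pi.single_eq_same]
    · rw [h1 l h, Pi.single_eq_of_ne h.ne']
  · rintro rfl
    refine ⟨⟨⟨fun l hl => Pi.single_eq_of_ne (by rintro rfl; omega) _, fun l hl => ?_⟩,
      fun l hl => Pi.single_eq_of_ne (by rintro rfl; omega) _⟩, Pi.single_eq_same _ _⟩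
    rw [single_one_vecMul]
    rcases (Nat.lt_succ_iff_lt_or_eq.1 hl) with h | h
    · rw [row_apply, hA.2 i l h, Pi.single_eq_of_ne (by rintro rfl; omega)]
    · rw [Fin.ext h]; simp [hA.1]

/-- Orthogonality of characters: `∑ c, ψ (c * x)` is `|F|` at `x = 0` and zero elsewhere. The term
`c = 0` gives the cardinality on the right. -/
lemma card_headVec_succ [Fintype Fˣ] (hA : IsUnitri A) (hψ : ψ.IsPrimitive) {i k : Fin n} (hik : i < k) :
    ((headVec A i (k + 1)).card : ℂ) =
      (headVec A i k).card + ∑ c : Fˣ, headSum ψ A i k c := by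
  classical
  have h1 : ((headVec A i k).card : ℂ) + ∑ c : Fˣ, headSum ψ A i k c =
      ∑ v ∈ headVec A i k, ∑ c : F, ψ (c * (v ᵥ* A) k) := by
    simp only [headSum]
    rw [Finset.sum_comm, Finset.card_eq_sum_ones, Nat.cast_sum, ← Finset.sum_add_distrib]
    refine Finset.sum_congr rfl fun v _ => ?_
    rw [sum_eq_zero_add_sum_units fun c : F => ψ (c * (v ᵥ* A) k)]
    simp
  -- Given the coordinates below `k`, being fixed at `k` means `(v A)_k = 0` for the truncated
  -- vector; the entry at `k` is then free.
  have h2 : (headVec A i (k + 1)).card = Fintype.card F *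
      ((headVec A i k).filter fun v => (v ᵥ* A) k = 0).card := by
    rw [← Finset.card_univ, ← Finset.card_product]
    refine Finset.card_nbij' (fun v => (v k, trunc k v))
      (fun p => p.2 + Pi.single k p.1) ?_ ?_ ?_ ?_
    · intro v hv
      have hv' := trunc_mem_headVec hA hik (Nat.le_succ _) hv
      simp only [Finset.coe_product, Set.mem_prod, Finset.mem_coe, Finset.mem_univ, true_and,
        Finset.mem_filter]
      refine ⟨hv', ?_⟩
      rw [Finset.mem_coe, mem_headVec, mem_tailVec, mem_fixedVec] at hv
      rw [vecMul_trunc_self hA, hv.1.1.2 k (Nat.lt_succ_self _), sub_self]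
    · rintro ⟨c, v⟩ hv
      simp only [Finset.coe_product, Set.mem_prod, Finset.mem_coe, Finset.mem_univ, true_and,
        Finset.mem_filter] at hv
      obtain ⟨hv, h0⟩ := hv
      rw [mem_headVec, mem_tailVec, mem_fixedVec] at hv
      simp only [Finset.mem_coe]
      rw [mem_headVec, mem_tailVec, mem_fixedVec]
      have hs : ∀ l : Fin n, (l : ℕ) < k → (Pi.single k c : Fin n → F) l = 0 :=
        fun l hl => Pi.single_eq_of_ne (by rintro rfl; omega) _
      refine ⟨⟨⟨fun l hl => ?_, fun l hl => ?_⟩, fun l hl => ?_⟩, ?_⟩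
      · rw [Pi.add_apply, hv.1.1.1 l (by omega), Pi.single_eq_of_ne (by rintro rfl; omega),
          add_zero]
      · rw [add_vecMul, Pi.add_apply, Pi.add_apply, single_vecMul]
        rcases (Nat.lt_succ_iff_lt_or_eq.1 hl) with h | h
        · rw [hv.1.1.2 l h, hs l h]
          simp [hA.2 k l h]
        · rw [Fin.ext h, h0, hv.1.1.1 k le_rfl]
          simp [hA.1]
      · rw [Pi.add_apply, hv.1.2 l hl, hs l (by rw [Fin.lt_def] at hik; omega), add_zero]
      · rw [Pi.add_apply, hv.2, hs i hik, add_zero]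
    · intro v hv
      simp only [Finset.mem_coe] at hv
      rw [mem_headVec, mem_tailVec, mem_fixedVec] at hv
      ext l
      change (if (l : ℕ) < k then v l else 0) + (Pi.single k (v k) : Fin n → F) l = v l
      rcases lt_trichotomy l k with h | h | h
      · rw [Pi.single_eq_of_ne h.ne, if_pos (by exact h), add_zero]
      · subst h; simp
      · rw [Pi.single_eq_of_ne h.ne', if_neg (by rw [Fin.lt_def] at h; omega),
          hv.1.1.1 l h, add_zero]
    · rintro ⟨c, v⟩ hv
      simp only [Finset.coe_product, Set.mem_prod, Finset.mem_coe, Finset.mem_univ, true_and,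
        Finset.mem_filter] at hv
      have hv := hv.1
      rw [mem_headVec, mem_tailVec] at hv
      have hvk := (mem_fixedVec.1 hv.1.1).1 k le_rfl
      refine Prod.ext (by simp [hvk]) ?_
      rw [← trunc_eq_self hv.1.1]
      ext l
      simp only [trunc, Pi.add_apply]
      split_ifs with h
      · rw [Pi.single_eq_of_ne (by rintro rfl; omega), add_zero]
      · rfl
  rw [h1, h2]
  simp_rw [AddChar.sum_mulShift _ hψ]
  rw [Nat.cast_mul, Finset.card_filter, Nat.cast_sum, Finset.mul_sum]
  refine Finset.sum_congr rfl fun v _ => ?_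
  split_ifs <;> simp

lemma headSum_zero (i k : Fin n) : headSum ψ A i k 0 = (headVec A i k).card := by
  simp [headSum]

/-- Sort the vectors by their leading position; the zero vector gives the `1`. The multiset is
chosen before `A`, so this is an identity of functions on the group. -/
lemma exists_tailSum_eq (k : Fin n) (a : Fˣ) {m : ℕ} (hm : m ≤ k) :
    ∃ N : Multiset (PosRoot n × Fˣ), (∀ z ∈ N, m ≤ z.1.row ∧ z.1.col = k) ∧
      ∀ A : Matrix (Fin n) (Fin n) F, tailSum ψ A m k a =
        1 + (N.map fun z => headSum ψ A z.1.row z.1.col z.2).sum := by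
  classical
  induction hm using Nat.decreasingInduction with
  | self => exact ⟨0, by simp, fun A => by simp [tailSum_self]⟩
  | of_succ m hm ih =>
    obtain ⟨N, hN, h⟩ := ih
    have hmk : (⟨m, hm.trans k.2⟩ : Fin n) < k := hm
    refine ⟨N + Finset.univ.val.map fun c : Fˣ => (⟨(⟨m, hm.trans k.2⟩, k), hmk⟩, a * c),
      fun z hz => ?_, fun A => ?_⟩
    · rcases Multiset.mem_add.1 hz with hz | hz
      · exact ⟨by have := (hN z hz).1; omega, (hN z hz).2⟩
      · obtain ⟨c, -, rfl⟩ := Multiset.mem_map.1 hz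
        exact ⟨le_rfl, rfl⟩
    · have := tailSum_eq_add_sum ψ (A := A) ⟨m, hm.trans k.2⟩ k a
      rw [this, h A, Multiset.map_add, Multiset.sum_add, Multiset.map_map, add_assoc]
      rfl

lemma exists_headSum_zero_eq (hψ : ψ.IsPrimitive) {i k : Fin n} (hik : i < k) :
    ∃ N : Multiset (PosRoot n × Fˣ), (∀ z ∈ N, z.1.row = i ∧ z.1.col < k) ∧
      ∀ A : Matrix (Fin n) (Fin n) F, IsUnitri A → headSum ψ A i k 0 =
        1 + (N.map fun z => headSum ψ A z.1.row z.1.col z.2).sum := by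
  classical
  obtain ⟨k, hk⟩ := k
  induction k, (show (i : ℕ) + 1 ≤ k from hik) using Nat.le_induction with
  | base => exact ⟨0, by simp, fun A hA => by simp [headSum_zero, card_headVec_self hA]⟩
  | succ k hle ih =>
    have hik' : i < ⟨k, by omega⟩ := hle
    obtain ⟨N, hN, h⟩ := ih (by omega) hle
    refine ⟨N + Finset.univ.val.map fun c : Fˣ => (⟨(i, ⟨k, by omega⟩), hik'⟩, c),
      fun z hz => ?_, fun A hA => ?_⟩
    · rcases Multiset.mem_add.1 hz with hz | hz
      · exact ⟨(hN z hz).1, (hN z hz).2.trans (Nat.lt_succ_self k)⟩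
      · obtain ⟨c, -, rfl⟩ := Multiset.mem_map.1 hz
        exact ⟨rfl, Nat.lt_succ_self k⟩
    · have h1 := card_headVec_succ ψ hA hψ hik'
      have h2 := h A hA
      rw [headSum_zero] at h2 ⊢
      simp only at h1 h2 ⊢
      rw [h1, h2, Multiset.map_add, Multiset.sum_add, Multiset.map_map, add_assoc]
      rfl

end Vectors

/-! ### Base groups, their linear characters, and the elementary characters -/

section Groups

variable {F : Type*} [Field F] {n : ℕ}

lemma coe_rootElement (α : PosRoot n) (c : F) :
    (rootElement F α c : Matrix (Fin n) (Fin n) F) = transvection α.row α.col c := rfl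

lemma rootElement_apply (α : PosRoot n) (c : F) (p q : Fin n) :
    (rootElement F α c : Matrix (Fin n) (Fin n) F) p q =
      (1 : Matrix (Fin n) (Fin n) F) p q + if α.row = p ∧ α.col = q then c else 0 := by
  rw [coe_rootElement, transvection, Matrix.add_apply, single_apply]

lemma rootElement_apply_posRoot (α β : PosRoot n) (c : F) :
    (rootElement F α c : Matrix (Fin n) (Fin n) F) β.row β.col = if α = β then c else 0 := by
  rw [rootElement_apply, one_apply_ne β.2.ne, zero_add]
  simp only [Subtype.ext_iff, Prod.ext_iff]

lemma rootElement_add (α : PosRoot n) (c d : F) :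
    rootElement F α (c + d) = rootElement F α c * rootElement F α d :=
  Units.ext (transvection_mul_transvection_same α.1.1 α.1.2 (ne_of_lt α.2) c d).symm

lemma rootElement_zero (α : PosRoot n) : rootElement F α 0 = 1 := by
  apply Units.ext
  simp [rootElement]

lemma isUnitri_rootElement (α : PosRoot n) (c : F) :
    IsUnitri (rootElement F α c : Matrix (Fin n) (Fin n) F) := by
  have := α.2
  refine ⟨fun i => ?_, fun i j hij => ?_⟩
  · rw [rootElement_apply, if_neg, one_apply_eq, add_zero]
    rintro ⟨h1, h2⟩
    exact this.ne (h1.trans h2.symm)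
  · rw [rootElement_apply, if_neg, one_apply_ne hij.ne', add_zero]
    rintro ⟨h1, h2⟩
    rw [← h1, ← h2] at hij
    exact this.not_gt hij

lemma isUnitri_one : IsUnitri (1 : Matrix (Fin n) (Fin n) F) :=
  ⟨fun i => one_apply_eq i, fun _ _ h => one_apply_ne h.ne'⟩

lemma IsUnitri.mul {A B : Matrix (Fin n) (Fin n) F} (hA : IsUnitri A) (hB : IsUnitri B) :
    IsUnitri (A * B) := by
  constructor
  · intro i
    rw [mul_apply, Finset.sum_eq_single i, hA.1, hB.1, one_mul]
    · intro m _ hm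
      rcases lt_or_gt_of_ne hm with h | h
      · rw [hA.2 i m h, zero_mul]
      · rw [hB.2 m i h, mul_zero]
    · simp
  · intro i j hij
    rw [mul_apply]
    refine Finset.sum_eq_zero fun m _ => ?_
    rcases lt_or_ge m i with h | h
    · rw [hA.2 i m h, zero_mul]
    · rw [hB.2 m j (hij.trans_le h), mul_zero]

lemma isUnitri_of_mem_U {g : GL (Fin n) F} (hg : g ∈ U F n) :
    IsUnitri (g : Matrix (Fin n) (Fin n) F) := by
  refine Subgroup.iSup_induction (fun α : PosRoot n => rootSubgroup F α)
    (C := fun g => IsUnitri (g : Matrix (Fin n) (Fin n) F)) hg ?_ isUnitri_one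
    fun x y hx hy => hx.mul hy
  rintro α _ ⟨c, rfl⟩
  exact isUnitri_rootElement α c

/-- A subgroup containing the root subgroups of all roots in `T` contains every unitriangular
matrix supported on `T`. -/
lemma mem_of_rootElement_mem {H : Subgroup (GL (Fin n) F)} (T : Finset (PosRoot n))
    (hT : ∀ β ∈ T, ∀ c, rootElement F β c ∈ H) :
    ∀ u : GL (Fin n) F, IsUnitri (u : Matrix (Fin n) (Fin n) F) →
      (∀ β : PosRoot n, β ∉ T → (u : Matrix (Fin n) (Fin n) F) β.row β.col = 0) → u ∈ H := by
  induction T using Finset.induction_on_max_value (fun β : PosRoot n => β.row) with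
  | empty =>
    intro u hu h
    convert H.one_mem
    apply Units.ext
    ext p q
    rcases lt_trichotomy p q with hpq | rfl | hpq
    · rw [Units.val_one, one_apply_ne hpq.ne]
      exact h ⟨(p, q), hpq⟩ (Finset.notMem_empty _)
    · rw [hu.1, Units.val_one, one_apply_eq]
    · rw [hu.2 _ _ hpq, Units.val_one, one_apply_ne hpq.ne']
  | insert α T hα hmax ih =>
    intro u hu h
    -- `α` has maximal row in the support and `α.col` lies below it, so row `α.col` of `u` is
    -- trivial. Left multiplication by `rootElement F α (-c)` thus clears the entry at `α` and
    -- changes no other.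
    have hrow : ∀ q, (u : Matrix (Fin n) (Fin n) F) α.col q = (1 : Matrix (Fin n) (Fin n) F)
        α.col q := by
      intro q
      rcases lt_trichotomy α.col q with hpq | rfl | hpq
      · rw [one_apply_ne hpq.ne]
        refine h ⟨(α.col, q), hpq⟩ fun hm => ?_
        have hα2 : α.row < α.col := α.2
        rcases Finset.mem_insert.1 hm with hm | hm
        · exact hα2.ne (congrArg PosRoot.row hm).symm
        · exact hα2.not_ge (hmax _ hm)
      · rw [hu.1, one_apply_eq]
      · rw [hu.2 _ _ hpq, one_apply_ne hpq.ne']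
    set c := (u : Matrix (Fin n) (Fin n) F) α.row α.col with hc
    have key : rootElement F α (-c) * u ∈ H := by
      refine ih (fun β hβ => hT β (Finset.mem_insert_of_mem hβ)) _
        ((isUnitri_rootElement α _).mul hu) fun β hβ => ?_
      rw [Units.val_mul, coe_rootElement]
      by_cases hr : β.row = α.row
      · rw [hr, transvection_mul_apply_same, hrow]
        by_cases hcol : α.col = β.col
        · rw [← hcol, one_apply_eq, ← hc]; ring
        · rw [one_apply_ne hcol, mul_zero, add_zero, ← hr]
          exact h β fun hm => (Finset.mem_insert.1 hm).elim
            (fun e => hcol (by rw [e])) hβ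
      · rw [transvection_mul_apply_of_ne _ _ _ _ hr]
        exact h β fun hm => (Finset.mem_insert.1 hm).elim
            (fun e => hr (by rw [e])) hβ
    have := H.mul_mem (hT α (Finset.mem_insert_self _ _) c) key
    rwa [← mul_assoc, ← rootElement_add, add_neg_cancel, rootElement_zero, one_mul] at this

lemma rootElement_mem_U (α : PosRoot n) (c : F) : rootElement F α c ∈ U F n :=
  Subgroup.mem_iSup_of_mem (S := fun α => rootSubgroup F α) α ⟨c, rfl⟩

lemma mem_U_of_isUnitri {g : GL (Fin n) F} (hg : IsUnitri (g : Matrix (Fin n) (Fin n) F)) :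
    g ∈ U F n :=
  mem_of_rootElement_mem Finset.univ (fun β _ c => rootElement_mem_U β c) g hg
    fun β hβ => absurd (Finset.mem_univ β) hβ

/-- The matrix of an element of `U F n`. -/
def mat (u : U F n) : Matrix (Fin n) (Fin n) F := ((u : GL (Fin n) F) : Matrix (Fin n) (Fin n) F)

lemma isUnitri_mat (u : U F n) : IsUnitri (mat u) := isUnitri_of_mem_U u.2

lemma mat_mul (u v : U F n) : mat (u * v) = mat u * mat v := rfl

lemma mat_one : mat (1 : U F n) = 1 := rfl

/-- The part of the row of `α` to the left of `α` in a matrix. -/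
def leftRow (α : PosRoot n) (u : U F n) : Fin n → F := trunc α.col ((mat u).row α.row)

lemma leftRow_mul (α : PosRoot n) (u v : U F n) :
    leftRow α (u * v) = trunc α.col (leftRow α u ᵥ* mat v) := by
  ext l
  rw [leftRow, leftRow, trunc, trunc]
  split_ifs with h
  · rw [vecMul_trunc_of_lt (isUnitri_mat v) _ h, mat_mul]
    rfl
  · rfl

lemma leftRow_one (α : PosRoot n) : leftRow α (1 : U F n) = Pi.single α.row 1 := by
  have hα : (α.row : ℕ) < α.col := α.2
  ext l
  rw [leftRow, mat_one, trunc]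
  split_ifs with h
  · rw [row_apply, one_apply, Pi.single_apply]
    simp only [eq_comm]
  · rw [Pi.single_eq_of_ne]
    rintro rfl
    exact h hα

lemma leftRow_eq_leftRow_one_iff (α : PosRoot n) (u : U F n) :
    leftRow α u = leftRow α 1 ↔ ∀ β ∈ arm α, mat u β.row β.col = 0 := by
  rw [leftRow_one]
  constructor
  · intro h β hβ
    have h1 := congrFun h β.col
    rw [leftRow, trunc, if_pos (by exact hβ.2), row_apply, Pi.single_eq_of_ne] at h1
    · rw [hβ.1, h1]
    · rw [← hβ.1]; exact β.2.ne'
  · intro h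
    ext l
    rw [leftRow, trunc, row_apply]
    have hα : (α.row : ℕ) < α.col := α.2
    rcases lt_trichotomy l α.row with hl | hl | hl
    · rw [(isUnitri_mat u).2 _ _ hl, Pi.single_eq_of_ne hl.ne, ite_self]
    · rw [hl, if_pos hα, (isUnitri_mat u).1, Pi.single_eq_same]
    · rw [Pi.single_eq_of_ne hl.ne']
      split_ifs with hlk
      · exact h ⟨(α.row, l), hl⟩ ⟨rfl, hlk⟩
      · rfl

/-- For `h` with trivial left part of the row of `α`, the entry at `α` is additive. -/
lemma mat_mul_apply_of_leftRow {α : PosRoot n} {h : U F n} (hh : leftRow α h = leftRow α 1)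
    (x : U F n) : mat (h * x) α.row α.col = mat h α.row α.col + mat x α.row α.col := by
  have h1 := vecMul_trunc_self (isUnitri_mat x) ((mat h).row α.row) α.col
  change (leftRow α h ᵥ* mat x) α.col = _ at h1
  rw [hh, leftRow_one, single_one_vecMul, eq_sub_iff_add_eq] at h1
  rw [mat_mul, mul_apply_eq_vecMul]
  rw [add_comm]
  exact h1.symm

lemma leftRow_mul_eq {α : PosRoot n} {u v : U F n} (h : leftRow α u = leftRow α v) (x : U F n) :
    leftRow α (u * x) = leftRow α (v * x) := by
  rw [leftRow_mul, h, leftRow_mul]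

lemma rootElement_mem_V {α β : PosRoot n} (hβ : β ∉ arm α) (c : F) :
    (⟨rootElement F β c, rootElement_mem_U β c⟩ : U F n) ∈ V F α := by
  have : (rootSubgroup F β).subgroupOf (U F n) ≤ V F α :=
    le_iSup₂_of_le (f := fun (β : PosRoot n) (_ : β ∉ arm α) =>
      (rootSubgroup F β).subgroupOf (U F n)) β hβ le_rfl
  exact this ⟨c, rfl⟩

lemma leftRow_of_mem_V {α : PosRoot n} {u : U F n} (hu : u ∈ V F α) :
    leftRow α u = leftRow α 1 := by
  refine Subgroup.iSup_induction _ (C := fun u => leftRow α u = leftRow α 1) hu ?_ rfl ?_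
  · intro β x hx
    by_cases hβ : β ∉ arm α
    · rw [iSup_pos hβ] at hx
      obtain ⟨c, hc⟩ := hx
      rw [leftRow_eq_leftRow_one_iff]
      intro γ hγ
      have : mat x = rootElement F β c := congrArg Units.val hc.symm
      rw [this, rootElement_apply_posRoot, if_neg]
      rintro rfl
      exact hβ hγ
    · rw [iSup_neg hβ, Subgroup.mem_bot] at hx
      rw [hx]
  · intro x y hx hy
    rw [leftRow_mul_eq hx, one_mul, hy]

/-- A subgroup of `V F α` containing all its root subgroups contains all `u` with vanishing
entries on the arm of `α`. -/
lemma mem_of_leftRow {α : PosRoot n} {H : Subgroup (U F n)}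
    (hH : ∀ β ∉ arm α, ∀ c, (⟨rootElement F β c, rootElement_mem_U β c⟩ : U F n) ∈ H)
    {u : U F n} (hu : leftRow α u = leftRow α 1) : u ∈ H := by
  classical
  rw [leftRow_eq_leftRow_one_iff] at hu
  have := mem_of_rootElement_mem (H := H.map (U F n).subtype)
    (Finset.univ.filter fun β => β ∉ arm α)
    (fun β hβ c => ⟨_, hH β (Finset.mem_filter.1 hβ).2 c, rfl⟩) u (isUnitri_mat u)
    fun β hβ => hu β (by simpa using hβ)
  obtain ⟨v, hv, hvu⟩ := this
  rwa [← Subtype.ext hvu]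

/-- `V F α` is the stabilizer of a unit vector under the right action of `U F n` on truncated rows.
-/
lemma mem_V_iff {α : PosRoot n} {u : U F n} : u ∈ V F α ↔ leftRow α u = leftRow α 1 :=
  ⟨leftRow_of_mem_V, mem_of_leftRow fun _ hβ c => rootElement_mem_V hβ c⟩

lemma mul_inv_mem_V_iff {α : PosRoot n} {x y : U F n} :
    x * y⁻¹ ∈ V F α ↔ leftRow α x = leftRow α y := by
  rw [mem_V_iff]
  constructor
  · intro h
    have := leftRow_mul_eq h y
    rwa [inv_mul_cancel_right, one_mul] at this
  · intro h
    have := leftRow_mul_eq h y⁻¹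
    rwa [mul_inv_cancel] at this

/-- The linear character `u ↦ ψ (a * u_α)` of `V F α`. -/
noncomputable def linChar (ψ : AddChar F ℂ) (α : PosRoot n) (a : F) : V F α →* ℂˣ :=
  MonoidHom.toHomUnits
    { toFun := fun u => ψ (a * mat (u : U F n) α.row α.col)
      map_one' := by
        rw [Subgroup.coe_one, mat_one, one_apply_ne (ne_of_lt α.2), mul_zero, AddChar.map_zero_eq_one]
      map_mul' := fun u v => by
        rw [Subgroup.coe_mul, mat_mul_apply_of_leftRow (leftRow_of_mem_V u.2), mul_add,
          AddChar.map_add_eq_mul] }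

lemma linChar_apply (ψ : AddChar F ℂ) (α : PosRoot n) (a : F) (u : V F α) :
    (linChar ψ α a u : ℂ) = ψ (a * mat (u : U F n) α.row α.col) := rfl

lemma notMem_arm_self (α : PosRoot n) : α ∉ arm α := fun h => lt_irrefl _ h.2

/-- The element of `V F α` given by an element of a root subgroup. -/
def rootElementV {α β : PosRoot n} (hβ : β ∉ arm α) (c : F) : V F α :=
  ⟨⟨rootElement F β c, rootElement_mem_U β c⟩, rootElement_mem_V hβ c⟩

lemma mat_rootElementV {α β : PosRoot n} (hβ : β ∉ arm α) (c : F) :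
    mat (rootElementV hβ c : U F n) α.row α.col = if β = α then c else 0 :=
  rootElement_apply_posRoot β α c

/-- The linear character of `V F α` with parameter `a`. -/
noncomputable def rootChar {ψ : AddChar F ℂ} (hψ : ψ.IsPrimitive) (α : PosRoot n) (a : Fˣ) :
    RootChar F α :=
  ⟨linChar ψ α a, by
    obtain ⟨c, hc⟩ := AddChar.ne_one_iff.1 (hψ a.ne_zero)
    refine ⟨rootElementV (notMem_arm_self α) c, ⟨c, rfl⟩, fun h => hc ?_⟩
    rw [Units.ext_iff, linChar_apply, mat_rootElementV, if_pos rfl] at h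
    exact h, by
    intro β hβ hne x ⟨c, hx⟩
    have hm : mat (x : U F n) = rootElement F β c := congrArg Units.val hx.symm
    rw [Units.ext_iff, linChar_apply, hm, rootElement_apply_posRoot, if_neg hne, mul_zero,
      AddChar.map_zero_eq_one, Units.val_one]⟩

/-- The restriction of `lam` to the root subgroup of `α` is an additive character of `F`, hence a
multiplicative shift of `ψ`. -/
lemma exists_eq_rootChar [Finite F] {ψ : AddChar F ℂ} (hψ : ψ.IsPrimitive) {α : PosRoot n}
    (lam : RootChar F α) : ∃ a : Fˣ, lam = rootChar hψ α a := by
  classical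
  cases nonempty_fintype F
  let χ : AddChar F ℂ :=
    { toFun := fun c => (lam.1 (rootElementV (notMem_arm_self α) c) : ℂ)
      map_zero_eq_one' := by
        have : rootElementV (notMem_arm_self α) (0 : F) = 1 :=
          Subtype.ext (Subtype.ext (rootElement_zero α))
        rw [this, map_one, Units.val_one]
      map_add_eq_mul' := fun c d => by
        have : rootElementV (notMem_arm_self α) (c + d) =
            rootElementV (notMem_arm_self α) c * rootElementV (notMem_arm_self α) d :=
          Subtype.ext (Subtype.ext (rootElement_add α c d))
        rw [this, map_mul, Units.val_mul] }
  have hbij : Function.Bijective (AddChar.mulShift ψ) := by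
    rw [Fintype.bijective_iff_injective_and_card, AddChar.card_eq]
    exact ⟨AddChar.to_mulShift_inj_of_isPrimitive hψ, rfl⟩
  obtain ⟨a, ha⟩ := hbij.2 χ
  have hχ : ∀ c, (lam.1 (rootElementV (notMem_arm_self α) c) : ℂ) = ψ (a * c) := fun c => by
    rw [← AddChar.mulShift_apply, ha]; rfl
  have ha0 : a ≠ 0 := by
    rintro rfl
    obtain ⟨x, ⟨c, hx⟩, hne⟩ := lam.2.1
    apply hne
    have : x = rootElementV (notMem_arm_self α) c := Subtype.ext (Subtype.ext hx.symm)
    rw [this, Units.ext_iff, hχ, zero_mul, AddChar.map_zero_eq_one, Units.val_one]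
  refine ⟨Units.mk0 a ha0, Subtype.ext (MonoidHom.ext fun u => ?_)⟩
  -- The locus where both characters agree contains every root subgroup outside the arm, hence all
  -- of `V F α`.
  have hu : (u : U F n) ∈ (lam.1.eqLocus (linChar ψ α a)).map (V F α).subtype := by
    refine mem_of_leftRow (α := α) (fun β hβ c => ?_) (leftRow_of_mem_V u.2)
    refine ⟨rootElementV hβ c, ?_, rfl⟩
    change lam.1 _ = linChar ψ α a _
    by_cases hβα : β = α
    · subst hβα
      rw [Units.ext_iff, hχ, linChar_apply, mat_rootElementV, if_pos rfl]
    · rw [lam.2.2 β hβ hβα _ ⟨c, rfl⟩, Units.ext_iff, linChar_apply, mat_rootElementV,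
        if_neg hβα, mul_zero, AddChar.map_zero_eq_one, Units.val_one]
  obtain ⟨w, hw, hwu⟩ := hu
  rw [← Subtype.ext hwu]
  exact hw

lemma exists_leftRow_eq (α : PosRoot n) {v : Fin n → F}
    (h0 : ∀ l < α.row, v l = 0) (h1 : v α.row = 1) (hk : ∀ l, α.col ≤ l → v l = 0) :
    ∃ y : U F n, leftRow α y = v := by
  obtain ⟨A, hAv, hA1⟩ : ∃ A : Matrix (Fin n) (Fin n) F, (∀ j, A α.row j = v j) ∧
      ∀ i ≠ α.row, ∀ j, A i j = (1 : Matrix (Fin n) (Fin n) F) i j :=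
    ⟨(1 : Matrix (Fin n) (Fin n) F).updateRow α.row v, fun j => by rw [updateRow_self],
      fun i hi j => by rw [updateRow_ne hi]⟩
  have hA : IsUnitri A := by
    refine ⟨fun i => ?_, fun i j hij => ?_⟩
    · by_cases h : i = α.row
      · rw [h, hAv, h1]
      · rw [hA1 i h, one_apply_eq]
    · by_cases h : i = α.row
      · rw [h, hAv, h0 _ (h ▸ hij)]
      · rw [hA1 i h, one_apply_ne hij.ne']
  have hdet : IsUnit A := by
    rw [isUnit_iff_isUnit_det, det_of_isUpperTriangular fun i j hij => hA.2 i j hij]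
    simp [hA.1]
  refine ⟨⟨hdet.unit, mem_U_of_isUnitri hA⟩, ?_⟩
  ext l
  change trunc α.col (A.row α.row) l = v l
  rw [trunc, row_apply, hAv]
  split_ifs with h
  · rfl
  · exact (hk l (not_lt.1 h)).symm

lemma card_leftRow_eq [Finite F] (α : PosRoot n) (y : U F n) :
    Nat.card {x : U F n // leftRow α x = leftRow α y} = Nat.card (V F α) := by
  refine Nat.card_congr
    { toFun := fun x => ⟨x * y⁻¹, mul_inv_mem_V_iff.2 x.2⟩
      invFun := fun h => ⟨h * y, mul_inv_mem_V_iff.1 (by rw [mul_inv_cancel_right]; exact h.2)⟩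
      left_inv := fun x => by simp
      right_inv := fun h => by simp }

lemma conj_mem_V_iff [Fintype F] {α : PosRoot n} {x g : U F n} :
    x * g * x⁻¹ ∈ V F α ↔ leftRow α x ∈ headVec (mat g) α.row α.col := by
  have hα : (α.row : ℕ) < α.col := α.2
  rw [mul_inv_mem_V_iff, leftRow_mul, mem_headVec, mem_tailVec, mem_fixedVec]
  constructor
  · intro h
    refine ⟨⟨⟨fun l hl => if_neg hl.not_gt, fun l hl => ?_⟩, fun l hl => ?_⟩, ?_⟩
    · rw [← congrFun h l, trunc, if_pos hl]
    · rw [leftRow, trunc, row_apply, (isUnitri_mat x).2 _ _ hl, ite_self]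
    · rw [leftRow, trunc, row_apply, (isUnitri_mat x).1, if_pos hα]
  · rintro ⟨⟨⟨h1, h2⟩, -⟩, -⟩
    ext l
    rw [trunc]
    split_ifs with hl
    · exact h2 l hl
    · exact (h1 l (not_lt.1 hl)).symm

/-- A summand of the induced character depends only on `leftRow α x`. Each fibre is a right coset of
`V F α`, whose size cancels the normalizing factor. -/
lemma elementaryChar_rootChar [Fintype F] {ψ : AddChar F ℂ} (hψ : ψ.IsPrimitive) (α : PosRoot n)
    (a : Fˣ) (g : U F n) :
    elementaryChar (rootChar hψ α a) g = headSum ψ (mat g) α.row α.col a := by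
  classical
  have hterm : ∀ x : U F n, (if h : x * g * x⁻¹ ∈ V F α then
      ((rootChar hψ α a).1 ⟨x * g * x⁻¹, h⟩ : ℂ) else 0) =
      if leftRow α x ∈ headVec (mat g) α.row α.col then
        ψ (a * (leftRow α x ᵥ* mat g) α.col) else 0 := by
    intro x
    by_cases h : x * g * x⁻¹ ∈ V F α
    · rw [dif_pos h, if_pos (conj_mem_V_iff.1 h)]
      change ψ (a * mat (x * g * x⁻¹) α.row α.col) = _
      have h1 := mat_mul_apply_of_leftRow (leftRow_of_mem_V h) x
      rw [inv_mul_cancel_right] at h1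
      rw [leftRow, vecMul_trunc_self (isUnitri_mat g), row_apply, eq_sub_of_add_eq h1.symm,
        mat_mul, mul_apply_eq_vecMul]
      rfl
    · rw [dif_neg h, if_neg fun h' => h (conj_mem_V_iff.2 h')]
  let := Fintype.ofFinite (U F n)
  have hV : (Nat.card (V F α) : ℂ) ≠ 0 := Nat.cast_ne_zero.2 Nat.card_pos.ne'
  rw [elementaryChar, inducedChar, inv_mul_eq_iff_eq_mul₀ hV]
  refine (Finset.sum_congr rfl fun x _ => hterm x).trans ?_
  rw [← Finset.sum_filter, headSum, Finset.mul_sum,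
    ← Finset.sum_fiberwise_of_maps_to (t := headVec (mat g) α.row α.col) (g := leftRow α)
      fun x hx => (Finset.mem_filter.1 hx).2]
  refine Finset.sum_congr rfl fun v hv => ?_
  rw [Finset.filter_filter, Finset.sum_congr rfl (g := fun _ => ψ (a * (v ᵥ* mat g) α.col))
    fun x hx => by rw [(Finset.mem_filter.1 hx).2.2], Finset.sum_const, nsmul_eq_mul]
  congr 2
  have hv' := hv
  rw [mem_headVec, mem_tailVec, mem_fixedVec] at hv'
  obtain ⟨y, rfl⟩ := exists_leftRow_eq α hv'.1.2 hv'.2 hv'.1.1.1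
  rw [← card_leftRow_eq α y, Nat.card_eq_fintype_card, Fintype.card_subtype]
  congr 1
  ext x
  simp only [Finset.mem_filter, Finset.mem_univ, true_and]
  exact ⟨fun h => h.2, fun h => ⟨h ▸ hv, h⟩⟩

end Groups

/-! ### Rewriting products of elementary characters by height -/

section Products

variable {F : Type*} [Field F] [Finite F] {n : ℕ} {ψ : AddChar F ℂ}

/-- The height of a root. -/
def height (α : PosRoot n) : ℕ := (α.col : ℕ) - α.row

lemma height_pos (α : PosRoot n) : 0 < height α := Nat.sub_pos_of_lt α.2

lemma height_lt_of_row_lt {α β : PosRoot n} (h : α.row < β.row) (hc : β.col = α.col) :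
    height β < height α := by
  have h2 : (β.row : ℕ) < β.col := β.2
  rw [Fin.lt_def] at h
  rw [height, height, ← hc]
  omega

lemma height_lt_of_col_lt {α β : PosRoot n} (h : β.col < α.col) (hr : β.row = α.row) :
    height β < height α := by
  have h2 : (β.row : ℕ) < β.col := β.2
  rw [Fin.lt_def] at h
  rw [height, height, ← hr]
  omega

lemma Separate.symm {α β : PosRoot n} (h : Separate α β) : Separate β α := ⟨h.1.symm, h.2.symm⟩

lemma eq_of_not_separate {α β : PosRoot n} (hs : ¬ Separate α β) (hh : height α = height β) :
    α = β := by
  by_cases hr : α.row = β.row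
  · rcases lt_trichotomy α.col β.col with h | h | h
    · exact absurd hh (height_lt_of_col_lt h hr).ne
    · exact Subtype.ext (Prod.ext hr h)
    · exact absurd hh (height_lt_of_col_lt h hr.symm).ne'
  · have hc : α.col = β.col := by
      by_contra hc
      exact hs ⟨hr, hc⟩
    rcases lt_or_gt_of_ne hr with h | h
    · exact absurd hh (height_lt_of_row_lt h hc.symm).ne'
    · exact absurd hh (height_lt_of_row_lt h hc).ne

/-- The elementary character attached to a root and a nonzero parameter. -/
noncomputable def elemChar (hψ : ψ.IsPrimitive) (z : PosRoot n × Fˣ) : U F n → ℂ :=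
  elementaryChar (rootChar hψ z.1 z.2)

lemma elemChar_apply [Fintype F] (hψ : ψ.IsPrimitive) (z : PosRoot n × Fˣ) (g : U F n) :
    elemChar hψ z g = headSum ψ (mat g) z.1.row z.1.col z.2 :=
  elementaryChar_rootChar hψ z.1 z.2 g

lemma sum_elemChar_apply [Fintype F] (hψ : ψ.IsPrimitive) (N : Multiset (PosRoot n × Fˣ))
    (g : U F n) : (N.map (elemChar hψ)).sum g =
      (N.map fun z => headSum ψ (mat g) z.1.row z.1.col z.2).sum := by
  refine (map_multiset_sum (Pi.evalAddMonoidHom (fun _ : U F n => ℂ) g) _).trans ?_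
  rw [Multiset.map_map]
  congr 1
  exact Multiset.map_congr rfl fun z _ => elemChar_apply hψ z g

/-- Of two distinct nonseparate roots, the product of the elementary characters is the longer one
times the sum of the trivial character and elementary characters at roots below the shorter one. -/
lemma elemChar_mul_of_not_separate (hψ : ψ.IsPrimitive) {x y : PosRoot n × Fˣ}
    (hs : ¬ Separate x.1 y.1) (hlt : height x.1 < height y.1) :
    ∃ N : Multiset (PosRoot n × Fˣ), (∀ z ∈ N, height z.1 < height x.1) ∧
      elemChar hψ x * elemChar hψ y = elemChar hψ y * (1 + (N.map (elemChar hψ)).sum) := by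
  cases nonempty_fintype F
  by_cases hr : x.1.row = y.1.row
  · have hc : x.1.col < y.1.col := by
      by_contra! h
      rcases h.lt_or_eq with h | h
      · exact hlt.not_gt (height_lt_of_col_lt h hr.symm)
      · rw [height, height, hr, h] at hlt
        exact lt_irrefl _ hlt
    have hx : x.1.row < x.1.col := x.1.2
    obtain ⟨N, hN, h⟩ := exists_tailSum_eq ψ x.1.col x.2 (m := x.1.row + 1) hx
    refine ⟨N, fun z hz => height_lt_of_row_lt (hN z hz).1 (hN z hz).2, ?_⟩
    ext g
    rw [Pi.mul_apply, Pi.mul_apply, Pi.add_apply, Pi.one_apply, sum_elemChar_apply, ← h,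
      elemChar_apply, elemChar_apply, ← hr,
      headSum_mul_headSum_same_row ψ (isUnitri_mat g) hx hc]
  · have hcol : x.1.col = y.1.col := by
      by_contra hc
      exact hs ⟨hr, hc⟩
    have hrow : y.1.row < x.1.row := by
      by_contra! h
      exact hlt.not_gt (height_lt_of_row_lt (h.lt_of_ne hr) hcol.symm)
    obtain ⟨N, hN, h⟩ := exists_headSum_zero_eq ψ hψ (show x.1.row < x.1.col from x.1.2)
    refine ⟨N, fun z hz => height_lt_of_col_lt (hN z hz).2 (hN z hz).1, ?_⟩
    ext g
    rw [Pi.mul_apply, Pi.mul_apply, Pi.add_apply, Pi.one_apply, sum_elemChar_apply,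
      ← h _ (isUnitri_mat g), elemChar_apply, elemChar_apply, ← hcol, mul_comm,
      headSum_mul_headSum_same_col ψ hrow y.2.ne_zero]

/-- The multisets of roots (with parameters) that may occur in the product of two elementary
characters at `α`. -/
def lowerMultisets (F : Type*) [Field F] (α : PosRoot n) : Set (Multiset (PosRoot n × Fˣ)) :=
  {N | (N.map fun z => height z.1).sum < 2 * height α ∧
    ∀ z ∈ N, z.1 = α ∨ height z.1 < height α}

/-- The product is the sum with parameter `a + b` times the trivial character plus shorter terms;
every resulting product has total height below `2 * height α`. -/
lemma elemChar_mul_of_eq (hψ : ψ.IsPrimitive) (α : PosRoot n) (a b : Fˣ) :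
    elemChar hψ (α, a) * elemChar hψ (α, b) ∈ AddSubmonoid.closure
      ((fun N : Multiset (PosRoot n × Fˣ) => (N.map (elemChar hψ)).prod) ''
        lowerMultisets F α) := by
  cases nonempty_fintype F
  have hα : α.row < α.col := α.2
  have hpos := height_pos α
  obtain ⟨N, hN, h⟩ := exists_tailSum_eq ψ α.col a (m := α.row + 1) hα
  replace hN : ∀ z ∈ N, height z.1 < height α :=
    fun z hz => height_lt_of_row_lt (hN z hz).1 (hN z hz).2
  set P := AddSubmonoid.closure
      ((fun N : Multiset (PosRoot n × Fˣ) => (N.map (elemChar hψ)).prod) '' lowerMultisets F α)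
    with hP
  have one_mem : (1 : U F n → ℂ) ∈ P :=
    AddSubmonoid.subset_closure ⟨0, ⟨by simpa using hpos, by simp⟩, by simp⟩
  have single_mem : ∀ z : PosRoot n × Fˣ, z.1 = α ∨ height z.1 < height α →
      elemChar hψ z ∈ P := fun z hz =>
    AddSubmonoid.subset_closure ⟨{z}, ⟨by
      rw [Multiset.map_singleton, Multiset.sum_singleton]
      rcases hz with hz | hz
      · rw [hz]; omega
      · omega, by simpa using hz⟩, by simp⟩
  have pair_mem : ∀ z w : PosRoot n × Fˣ, (z.1 = α ∨ height z.1 < height α) →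
      height w.1 < height α → elemChar hψ z * elemChar hψ w ∈ P := fun z w hz hw =>
    AddSubmonoid.subset_closure ⟨{z, w}, ⟨by
      simp only [Multiset.insert_eq_cons, Multiset.map_cons, Multiset.map_singleton,
        Multiset.sum_cons, Multiset.sum_singleton]
      rcases hz with hz | hz
      · rw [hz]; omega
      · omega, by
      simp only [Multiset.insert_eq_cons, Multiset.mem_cons, Multiset.mem_singleton]
      rintro _ (rfl | rfl)
      · exact hz
      · exact Or.inr hw⟩, by simp⟩
  have mul_mem : ∀ z : PosRoot n × Fˣ, (z.1 = α ∨ height z.1 < height α) →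
      elemChar hψ z * (1 + (N.map (elemChar hψ)).sum) ∈ P := fun z hz => by
    rw [mul_add, mul_one, ← Multiset.sum_map_mul_left]
    refine P.add_mem (single_mem z hz) (P.multiset_sum_mem _ fun f hf => ?_)
    obtain ⟨w, hw, rfl⟩ := Multiset.mem_map.1 hf
    exact pair_mem z w hz (hN w hw)
  -- With parameter zero the first factor is no elementary character but a count of fixed vectors,
  -- and is expanded in turn.
  by_cases hab : (a : F) + b = 0
  · obtain ⟨M, hM, h'⟩ := exists_headSum_zero_eq ψ hψ hα
    have : elemChar hψ (α, a) * elemChar hψ (α, b) =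
        (1 + (M.map (elemChar hψ)).sum) * (1 + (N.map (elemChar hψ)).sum) := by
      ext g
      simp only [Pi.mul_apply, Pi.add_apply, Pi.one_apply, sum_elemChar_apply, elemChar_apply]
      rw [← h, ← h' _ (isUnitri_mat g), headSum_mul_headSum_same_root, hab]
    rw [this, add_mul, one_mul, ← Multiset.sum_map_mul_right]
    refine P.add_mem (P.add_mem one_mem (P.multiset_sum_mem _ fun f hf => ?_))
      (P.multiset_sum_mem _ fun f hf => ?_)
    · obtain ⟨w, hw, rfl⟩ := Multiset.mem_map.1 hf
      exact single_mem w (Or.inr (hN w hw))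
    · obtain ⟨w, hw, rfl⟩ := Multiset.mem_map.1 hf
      exact mul_mem w (Or.inr (height_lt_of_col_lt (hM w hw).2 (hM w hw).1))
  · have : elemChar hψ (α, a) * elemChar hψ (α, b) =
        elemChar hψ (α, Units.mk0 _ hab) * (1 + (N.map (elemChar hψ)).sum) := by
      ext g
      simp only [Pi.mul_apply, Pi.add_apply, Pi.one_apply, sum_elemChar_apply, elemChar_apply]
      rw [← h, headSum_mul_headSum_same_root, Units.val_mk0]
    rw [this]
    exact mul_mem _ (Or.inl rfl)

/-- A product of elementary characters at pairwise separate roots is a basic character. -/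
lemma prod_elemChar_mem_range (hψ : ψ.IsPrimitive) {M : Multiset (PosRoot n × Fˣ)} (h0 : M ≠ 0)
    (hnd : M.Nodup) (hsep : ∀ z ∈ M, ∀ w ∈ M, z ≠ w → Separate z.1 w.1) :
    (M.map (elemChar hψ)).prod ∈ Set.range (basicChar (F := F) (n := n)) := by
  classical
  have hinj : ∀ z ∈ M, ∀ w ∈ M, z.1 = w.1 → z = w := fun z hz w hw h => by
    by_contra hne
    exact (hsep z hz w hw hne).1 (by rw [h])
  have hnd' : (M.map Prod.fst).Nodup := hnd.map_on hinj
  let D : Finset (PosRoot n) := ⟨M.map Prod.fst, hnd'⟩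
  have hD : ∀ α : PosRoot n, ∃ a : Fˣ, α ∈ D → (α, a) ∈ M := by
    intro α
    by_cases hα : α ∈ D
    · obtain ⟨z, hz, rfl⟩ := Multiset.mem_map.1 (Finset.mem_mk.1 hα)
      exact ⟨z.2, fun _ => hz⟩
    · exact ⟨1, fun h => absurd h hα⟩
  choose a ha using hD
  refine ⟨⟨D, ⟨?_, ?_⟩, fun α => rootChar hψ α.1 (a α.1)⟩, ?_⟩
  · obtain ⟨z, hz⟩ := Multiset.exists_mem_of_ne_zero h0
    exact ⟨z.1, Multiset.mem_map_of_mem _ hz⟩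
  · intro α hα β hβ hne
    exact hsep _ (ha α hα) _ (ha β hβ) fun h => hne (congrArg Prod.fst h)
  · rw [basicChar, tensorChar]
    change ∏ α : D, elemChar hψ (α.1, a α.1) = _
    rw [Finset.prod_coe_sort D fun α => elemChar hψ (α, a α), Finset.prod]
    change ((M.map Prod.fst).map _).prod = _
    rw [Multiset.map_map]
    congr 1
    refine Multiset.map_congr rfl fun z hz => ?_
    have : (z.1, a z.1) = z := hinj _ (ha z.1 (Multiset.mem_map_of_mem _ hz)) _ hz rfl
    rw [Function.comp_apply, this]

/-- Strong induction on the total height of `M`. Excluding the root of `β` from `M` prevents the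
equal-root case, which could cancel both factors, from ever involving `β`. -/
lemma elemChar_mul_prod_mem (hψ : ψ.IsPrimitive) (β : PosRoot n × Fˣ)
    (M : Multiset (PosRoot n × Fˣ))
    (hM : ∀ z ∈ M, height z.1 ≤ height β.1 ∧ z.1 ≠ β.1) :
    elemChar hψ β * (M.map (elemChar hψ)).prod ∈
      AddSubmonoid.closure (Set.range (basicChar (F := F) (n := n))) := by
  induction hs : (M.map fun z => height z.1).sum using Nat.strong_induction_on
    generalizing M with
  | _ s ih =>
  subst hs
  have pair_case : ∀ z w M', M = z ::ₘ w ::ₘ M' → ¬ Separate z.1 w.1 →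
      height z.1 < height w.1 → elemChar hψ β * (M.map (elemChar hψ)).prod ∈
        AddSubmonoid.closure (Set.range (basicChar (F := F) (n := n))) := by
    rintro z w M' rfl hzw hlt
    obtain ⟨N, hN, h⟩ := elemChar_mul_of_not_separate hψ hzw hlt
    have hz := hM z (Multiset.mem_cons_self _ _)
    have hpos := height_pos z.1
    have : elemChar hψ β * ((z ::ₘ w ::ₘ M').map (elemChar hψ)).prod =
        elemChar hψ β * ((w ::ₘ M').map (elemChar hψ)).prod +
          (N.map fun u =>
            elemChar hψ β * ((u ::ₘ w ::ₘ M').map (elemChar hψ)).prod).sum := by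
      simp only [Multiset.map_cons, Multiset.prod_cons, ← mul_assoc, Multiset.sum_map_mul_right,
        Multiset.sum_map_mul_left]
      rw [mul_assoc (elemChar hψ β), h]
      ring
    rw [this]
    refine add_mem (ih _ ?_ _ (fun u hu => hM u (Multiset.mem_cons_of_mem hu)) rfl)
      (AddSubmonoid.multiset_sum_mem _ _ fun f hf => ?_)
    · rw [Multiset.map_cons _ z, Multiset.sum_cons]; omega
    · obtain ⟨u, hu, rfl⟩ := Multiset.mem_map.1 hf
      have hu' := hN u hu
      refine ih _ ?_ _ (fun v hv => ?_) rfl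
      · simp only [Multiset.map_cons, Multiset.sum_cons]; omega
      · rcases Multiset.mem_cons.1 hv with rfl | hv
        · exact ⟨by omega, fun e => by rw [e] at hu'; omega⟩
        · exact hM v (Multiset.mem_cons_of_mem hv)
  by_cases hβ : ∃ z ∈ M, ¬ Separate z.1 β.1
  · obtain ⟨z, hz, hzβ⟩ := hβ
    obtain ⟨M', rfl⟩ := Multiset.exists_cons_of_mem hz
    have hlt : height z.1 < height β.1 :=
      (hM z hz).1.lt_of_ne fun e => (hM z hz).2 (eq_of_not_separate hzβ e)
    obtain ⟨N, hN, h⟩ := elemChar_mul_of_not_separate hψ hzβ hlt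
    have hpos := height_pos z.1
    have : elemChar hψ β * ((z ::ₘ M').map (elemChar hψ)).prod =
        elemChar hψ β * (M'.map (elemChar hψ)).prod +
          (N.map fun u => elemChar hψ β * ((u ::ₘ M').map (elemChar hψ)).prod).sum := by
      simp only [Multiset.map_cons, Multiset.prod_cons, ← mul_assoc, Multiset.sum_map_mul_right,
        Multiset.sum_map_mul_left]
      rw [mul_comm (elemChar hψ β), h]
      ring
    rw [this]
    refine add_mem (ih _ ?_ _ (fun u hu => hM u (Multiset.mem_cons_of_mem hu)) rfl)
      (AddSubmonoid.multiset_sum_mem _ _ fun f hf => ?_)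
    · rw [Multiset.map_cons, Multiset.sum_cons]; omega
    · obtain ⟨u, hu, rfl⟩ := Multiset.mem_map.1 hf
      have hu' := hN u hu
      refine ih _ ?_ _ (fun v hv => ?_) rfl
      · simp only [Multiset.map_cons, Multiset.sum_cons]; omega
      · rcases Multiset.mem_cons.1 hv with rfl | hv
        · exact ⟨by omega, fun e => by rw [e] at hu'; omega⟩
        · exact hM v (Multiset.mem_cons_of_mem hv)
  push Not at hβ
  -- Splitting off two members also covers a repeated one; as no root is separate from itself, the
  -- condition forces `M` to be duplicate-free.
  by_cases hMs : ∀ z w M', M = z ::ₘ w ::ₘ M' → Separate z.1 w.1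
  · rw [← Multiset.prod_cons, ← Multiset.map_cons]
    refine AddSubmonoid.subset_closure (prod_elemChar_mem_range hψ Multiset.cons_ne_zero ?_ ?_)
    · refine Multiset.nodup_cons.2 ⟨fun h => (hM β h).2 rfl, ?_⟩
      rw [Multiset.nodup_iff_ne_cons_cons]
      exact fun z M' h => (hMs z z M' h).1 rfl
    · intro z hz w hw hne
      rcases Multiset.mem_cons.1 hz with rfl | hzM
      · exact (hβ w ((Multiset.mem_cons.1 hw).resolve_left hne.symm)).symm
      · rcases Multiset.mem_cons.1 hw with rfl | hw
        · exact hβ z hzM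
        · obtain ⟨M', rfl⟩ := Multiset.exists_cons_of_mem hzM
          obtain ⟨M'', rfl⟩ := Multiset.exists_cons_of_mem
            ((Multiset.mem_cons.1 hw).resolve_left hne.symm)
          exact hMs z w M'' rfl
  push Not at hMs
  obtain ⟨z, w, M', rfl, hzw⟩ := hMs
  rcases lt_trichotomy (height z.1) (height w.1) with h | h | h
  · exact pair_case z w M' rfl hzw h
  · obtain ⟨α, a⟩ := z
    obtain ⟨α', b⟩ := w
    obtain rfl : α = α' := eq_of_not_separate hzw h
    have hα := hM (α, a) (Multiset.mem_cons_self _ _)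
    rw [Multiset.map_cons, Multiset.map_cons, Multiset.prod_cons, Multiset.prod_cons,
      ← mul_assoc (elemChar hψ (α, a)), mul_left_comm]
    have hmem := elemChar_mul_of_eq hψ α a b
    -- The goal is additive in the product of the two equal-root factors, so it suffices to treat
    -- the generators of the closure.
    generalize elemChar hψ (α, a) * elemChar hψ (α, b) = f at hmem ⊢
    induction hmem using AddSubmonoid.closure_induction with
    | mem f hf =>
      obtain ⟨N, ⟨hN, hN'⟩, rfl⟩ := hf
      have := ih ((N + M').map fun z => height z.1).sum ?_ (N + M') (fun z hz => ?_) rfl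
      · rwa [Multiset.map_add, Multiset.prod_add, mul_left_comm] at this
      · simp only [Multiset.map_add, Multiset.sum_add, Multiset.map_cons, Multiset.sum_cons]
        omega
      · rcases Multiset.mem_add.1 hz with hz | hz
        · rcases hN' z hz with e | e
          · rw [e]; exact hα
          · exact ⟨e.le.trans hα.1, fun e' => by
              rw [e'] at e; exact absurd hα.1 e.not_ge⟩
        · exact hM z (Multiset.mem_cons_of_mem (Multiset.mem_cons_of_mem hz))
    | zero => rw [zero_mul]; exact zero_mem _
    | add f g _ _ hf hg => rw [add_mul]; exact add_mem hf hg
  · exact pair_case w z M' (Multiset.cons_swap _ _ _) (fun h => hzw h.symm) h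

end Products

end UnitriChar

theorem corollary3p5 {F : Type*} [Field F] [Finite F] (n : ℕ)
    (S : Finset (UnitriChar.PosRoot n)) (hS : S.Nonempty)
    (phi : ∀ α : S, UnitriChar.RootChar F α.1) :
    ∃ B : Multiset (UnitriChar.BasicIndex F n),
      UnitriChar.tensorChar S phi = (B.map UnitriChar.basicChar).sum := by
  classical
  have hψ : (AddChar.FiniteField.primitiveChar_to_Complex F).IsPrimitive :=
    AddChar.FiniteField.primitiveChar_to_Complex_isPrimitive F
  choose a ha using fun α : S => UnitriChar.exists_eq_rootChar hψ (phi α)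
  -- The factor set aside; `S` has no repeated roots, so the others lie at different roots of at
  -- most this height.
  obtain ⟨β, -, hβ⟩ := Finset.exists_max_image Finset.univ
    (fun α : S => UnitriChar.height α.1) ⟨⟨_, hS.choose_spec⟩, Finset.mem_univ _⟩
  have key := UnitriChar.elemChar_mul_prod_mem hψ (β.1, a β)
    ((Finset.univ.erase β).val.map fun α : S => (α.1, a α)) fun z hz => by
      obtain ⟨α, hα, rfl⟩ := Multiset.mem_map.1 hz
      exact ⟨hβ α (Finset.mem_univ _),
        fun e => (Finset.mem_erase.1 hα).1 (Subtype.ext e)⟩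
  have heq : UnitriChar.tensorChar S phi = UnitriChar.elemChar hψ (β.1, a β) *
      (((Finset.univ.erase β).val.map fun α : S => (α.1, a α)).map
        (UnitriChar.elemChar hψ)).prod := by
    rw [UnitriChar.tensorChar, ← Finset.mul_prod_erase _ _ (Finset.mem_univ β), Multiset.map_map]
    refine congrArg₂ _ (by rw [ha β]; rfl) ?_
    exact Finset.prod_congr rfl fun α _ => by rw [ha α]; rfl
  rw [← heq] at key
  generalize UnitriChar.tensorChar S phi = f at key ⊢
  induction key using AddSubmonoid.closure_induction with
  | mem f hf =>
    obtain ⟨b, rfl⟩ := hf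
    exact ⟨{b}, by simp⟩
  | zero => exact ⟨0, by simp⟩
  | add f g _ _ hf hg =>
    obtain ⟨B, rfl⟩ := hf
    obtain ⟨C, rfl⟩ := hg
    exact ⟨B + C, by simp⟩
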